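/- Let $K$ be a field equipped with a non-trivial non-archimedean absolute value $|\cdot|$, complete for the induced metric and spherically complete (every decreasing sequence of closed balls in $K$ has non-empty intersection), and let $B_K=\{a\in K:|a|\le 1\}$. A locally convex space over $K$ is a topological $K$-vector space, not necessarily Hausdorff, whose topology is defined by a family of non-archimedean seminorms (seminorms $p$ with $p(x+y)\le\max(p(x),p(y))$). A subset of such a space is absolutely convex if it is a $B_K$-submodule, and convex if it is of the form $x+C$ with $C$ absolutely convex. Let $E$ be a locally convex space over $K$ and let $A\subseteq E$ be absolutely convex. A convex filter on $A$ is a proper filter on $A$ that has a base of convex sets; it is maximal if no convex filter on $A$ is strictly finer. The set $A$ is called c-precompact if every maximal convex filter on $A$ is a Cauchy filter. An absolutely convex subset $X$ of a locally convex space $G$ is called a local compactoid in $G$ if for every neighbourhood $U$ of $0$ in $G$ there is a finite set $T\subseteq G$ such that $X\subseteq U+[T]$, where $[T]$ denotes the $K$-linear span of $T$. Then the following two conditions are equivalent. (1) $A$ is c-precompact. (2) There exist a locally convex space $G$ over $K$ and a continuous linear map $f:E\to G$ that is a homeomorphism onto its image such that $f(A)$ is a local compactoid in $G$. -/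

import Mathlib

open scoped Topology Pointwise

universe u v w

/-- `K` is spherically complete: every decreasing sequence of closed balls (of positive radius)
has a common point. -/
def IsSphericallyComplete (K : Type*) [PseudoMetricSpace K] : Prop :=
  ∀ (c : ℕ → K) (r : ℕ → ℝ), (∀ n, 0 < r n) →
    (∀ n, Metric.closedBall (c (n + 1)) (r (n + 1)) ⊆ Metric.closedBall (c n) (r n)) →
    (⋂ n, Metric.closedBall (c n) (r n)).Nonempty

/-- The topology of `E` is defined by a family of non-archimedean seminorms, i.e. seminorms `p`
with `p (x + y) ≤ max (p x) (p y)`. -/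
def IsNonarchLocallyConvex (K E : Type*) [NormedField K] [AddCommGroup E] [Module K E]
    [TopologicalSpace E] : Prop :=
  ∃ P : Set (Seminorm K E), (∀ p ∈ P, IsNonarchimedean (p : E → ℝ)) ∧
    WithSeminorms (fun p : P => (p : Seminorm K E))

/-- `A` is absolutely convex: it is a submodule of `E` over the unit ball
`{a : K | ‖a‖ ≤ 1}` of `K`. -/
structure IsNonarchAbsConvex (K : Type*) {E : Type*} [NormedField K] [AddCommGroup E] [Module K E]
    (A : Set E) : Prop where
  zero_mem : (0 : E) ∈ A
  add_mem : ∀ x ∈ A, ∀ y ∈ A, x + y ∈ A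
  smul_mem : ∀ a : K, ‖a‖ ≤ 1 → ∀ x ∈ A, a • x ∈ A

/-- `C` is convex: it is a translate `x + A` of an absolutely convex set `A`. -/
def IsNonarchConvex (K : Type*) {E : Type*} [NormedField K] [AddCommGroup E] [Module K E]
    (C : Set E) : Prop :=
  ∃ (x : E) (A : Set E), IsNonarchAbsConvex K A ∧ C = x +ᵥ A

/-- `F` is a (proper) convex filter on `A`: a filter on `A`, seen as a filter on `E` that
contains `A`, which has a base of convex sets. -/
structure IsConvexFilterOn (K : Type*) {E : Type*} [NormedField K] [AddCommGroup E] [Module K E]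
    (A : Set E) (F : Filter E) : Prop where
  neBot : F.NeBot
  mem : A ∈ F
  exists_convex : ∀ S ∈ F, ∃ C ∈ F, C ⊆ S ∧ IsNonarchConvex K C

/-- `F` is a maximal convex filter on `A`: no convex filter on `A` is strictly finer
(in Mathlib's order on filters, finer filters are smaller). -/
def IsMaximalConvexFilterOn (K : Type*) {E : Type*} [NormedField K] [AddCommGroup E] [Module K E]
    (A : Set E) (F : Filter E) : Prop :=
  Minimal (IsConvexFilterOn K A) F

/-- `A` is c-precompact: it is absolutely convex and every maximal convex filter on `A` is a
Cauchy filter for the uniform structure of the topological group `E`. -/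
def IsCPrecompact (K : Type*) {E : Type*} [NormedField K] [AddCommGroup E] [Module K E]
    [TopologicalSpace E] [IsTopologicalAddGroup E] (A : Set E) : Prop :=
  IsNonarchAbsConvex K A ∧
    ∀ F : Filter E, IsMaximalConvexFilterOn K A F →
      @Cauchy E (IsTopologicalAddGroup.rightUniformSpace E) F

/-- `A` is a local compactoid in `E`: it is absolutely convex and, for every zero neighbourhood
`U` in `E`, there is a finite set `T ⊆ E` with `A ⊆ U + [T]`, where `[T]` is the linear span. -/
def IsLocalCompactoid (K : Type*) {E : Type*} [NormedField K] [AddCommGroup E] [Module K E]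
    [TopologicalSpace E] (A : Set E) : Prop :=
  IsNonarchAbsConvex K A ∧
    ∀ U ∈ 𝓝 (0 : E), ∃ T : Finset E, A ⊆ U + (Submodule.span K (T : Set E) : Set E)

/-! ### Convex sets without a base point, and non-archimedean seminorms -/

section Convex

variable {K : Type*} [NormedField K] {E : Type*} [AddCommGroup E] [Module K E]

/-! Spherical completeness enters twice: finite-dimensional spaces are linearly compact (directed
families of convex sets have a common point), and the quotients `K ⧸ closedBallSubmodule K r hr` are
injective modules over the unit ball.

(2) ⇒ (1): modulo a seminorm ball, `f '' A` lies in a finite-dimensional span. Linear compactness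
gives a point of that span close to every convex member of a maximal convex filter; the ball around
it then belongs to the filter by maximality, so the filter is Cauchy.

(1) ⇒ (2): fix a continuous seminorm `p`. A subset of `A` independent modulo `{p ≤ 1}` is finite,
since an infinite one yields a convex filter with no finer Cauchy filter
(`IsCPrecompact.finite_of_isIndepMod`). A maximal one is essential in `A`, and injectivity extends
its coefficient maps to functionals. Hence `A` modulo `{p ≤ 1}` embeds in a finite product of
quotients of `K` by balls (`IsCPrecompact.exists_functionals`). By injectivity again, each
functional bounded by 1 on `{p ≤ 1}` is, on `A` and up to error 1, a combination of these finitely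
many, with uniformly bounded coefficients (`IsCPrecompact.exists_approximation`). Now map `E` by
evaluation into bounded functions on the dual balls: the bounded coefficient functions are vectors
of the target whose span approximates the image of `A`. Hahn–Banach makes evaluation inducing, and
an indiscrete factor `E` makes it injective. -/

theorem isNonarchConvex_iff {C : Set E} :
    IsNonarchConvex K C ↔ C.Nonempty ∧
      ∀ x ∈ C, ∀ y ∈ C, ∀ z ∈ C, ∀ a : K, ‖a‖ ≤ 1 → x + a • (y - z) ∈ C := by
  constructor
  · rintro ⟨x₀, A, hA, rfl⟩
    refine ⟨⟨x₀ + 0, 0, hA.zero_mem, rfl⟩, ?_⟩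
    rintro _ ⟨x, hx, rfl⟩ _ ⟨y, hy, rfl⟩ _ ⟨z, hz, rfl⟩ a ha
    refine ⟨x + a • (y + (-1 : K) • z), ?_, ?_⟩
    · exact hA.add_mem _ hx _ (hA.smul_mem _ ha _ (hA.add_mem _ hy _
        (hA.smul_mem _ (by simp) _ hz)))
    · simp only [vadd_eq_add]
      module
  · rintro ⟨⟨x₀, hx₀⟩, h⟩
    -- Any point of `C` can serve as the base point; translating it to zero gives the submodule.
    refine ⟨x₀, (fun y => x₀ + y) ⁻¹' C, ⟨by simpa using hx₀, ?_, ?_⟩, ?_⟩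
    · intro x hx y hy
      have := h _ hx _ hy _ hx₀ 1 (by simp)
      simp only [Set.mem_preimage] at hx hy ⊢
      convert this using 1
      module
    · intro a ha x hx
      have := h _ hx₀ _ hx _ hx₀ a ha
      simpa using this
    · ext y
      simp [Set.mem_vadd_set_iff_neg_vadd_mem]

theorem IsNonarchConvex.nonempty {C : Set E} (hC : IsNonarchConvex K C) : C.Nonempty :=
  (isNonarchConvex_iff.1 hC).1

theorem IsNonarchConvex.add_smul_sub_mem {C : Set E} (hC : IsNonarchConvex K C) {x y z : E}
    (hx : x ∈ C) (hy : y ∈ C) (hz : z ∈ C) {a : K} (ha : ‖a‖ ≤ 1) : x + a • (y - z) ∈ C :=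
  (isNonarchConvex_iff.1 hC).2 x hx y hy z hz a ha

theorem IsNonarchConvex.inter {C D : Set E} (hC : IsNonarchConvex K C) (hD : IsNonarchConvex K D)
    (h : (C ∩ D).Nonempty) : IsNonarchConvex K (C ∩ D) :=
  isNonarchConvex_iff.2 ⟨h, fun _ hx _ hy _ hz _ ha =>
    ⟨hC.add_smul_sub_mem hx.1 hy.1 hz.1 ha, hD.add_smul_sub_mem hx.2 hy.2 hz.2 ha⟩⟩

theorem IsNonarchAbsConvex.isNonarchConvex {A : Set E} (hA : IsNonarchAbsConvex K A) :
    IsNonarchConvex K A :=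
  ⟨0, A, hA, by simp⟩

theorem isNonarchAbsConvex_seminorm (p : Seminorm K E) (hp : IsNonarchimedean (p : E → ℝ)) (r : ℝ)
    (hr : 0 ≤ r) : IsNonarchAbsConvex K {x | p x ≤ r} where
  zero_mem := by simpa using hr
  add_mem x hx y hy := (hp x y).trans (max_le hx hy)
  smul_mem a ha x hx := by
    simp only [Set.mem_ofPred_eq, map_smul_eq_mul] at hx ⊢
    exact (mul_le_of_le_one_left (apply_nonneg p x) ha).trans hx

theorem IsNonarchimedean.seminorm_sub_le {p : Seminorm K E}
    (hp : IsNonarchimedean (p : E → ℝ)) {x y : E} {r : ℝ} (hx : p x ≤ r) (hy : p y ≤ r) :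
    p (x - y) ≤ r := by
  rw [sub_eq_add_neg]
  exact (hp _ _).trans (max_le hx (by rwa [map_neg_eq_map]))

/-- A neighbourhood of zero contains the unit ball of a continuous non-archimedean seminorm. -/
theorem IsNonarchLocallyConvex.exists_seminorm {K : Type*} [NontriviallyNormedField K]
    {E : Type*} [AddCommGroup E] [Module K E] [TopologicalSpace E]
    (hE : IsNonarchLocallyConvex K E) {U : Set E} (hU : U ∈ 𝓝 (0 : E)) :
    ∃ p : Seminorm K E, Continuous p ∧ IsNonarchimedean (p : E → ℝ) ∧ {x | p x ≤ 1} ⊆ U := by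
  obtain ⟨P, hP, hw⟩ := hE
  have := hw.topologicalAddGroup
  have := hw.continuousSMul
  obtain ⟨⟨s, r⟩, hr, hs⟩ := hw.hasBasis_zero_ball.mem_iff.1 hU
  simp only at hr hs
  have hcont : ∀ s : Finset P,
      Continuous (s.sup (fun p : P => (p : Seminorm K E)) : Seminorm K E) := by
    classical
    intro s
    induction s using Finset.induction_on with
    | empty =>
      rw [Finset.sup_empty]
      exact continuous_const (y := (0 : ℝ))
    | insert i t _ ih =>
      rw [Finset.sup_insert, Seminorm.coe_sup]
      exact (hw.continuous_seminorm i).max ih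
  set q : Seminorm K E := s.sup (fun p : P => (p : Seminorm K E)) with hq
  have hqc : Continuous q := hcont s
  have hqn : IsNonarchimedean (q : E → ℝ) := by
    intro x y
    refine Seminorm.finset_sup_apply_le (le_max_of_le_left (apply_nonneg _ _)) fun i hi => ?_
    refine (hP i i.2 x y).trans (max_le_max ?_ ?_)
    · exact Seminorm.le_finset_sup_apply hi
    · exact Seminorm.le_finset_sup_apply hi
  have hr' : 0 < 2 / r := by positivity
  refine ⟨(NNReal.mk (2 / r) hr'.le) • q, ?_, ?_, ?_⟩
  · exact hqc.const_smul (NNReal.mk (2 / r) hr'.le)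
  · intro x y
    change 2 / r * q (x + y) ≤ max (2 / r * q x) (2 / r * q y)
    rw [← mul_max_of_nonneg _ _ hr'.le]
    exact mul_le_mul_of_nonneg_left (hqn x y) hr'.le
  · intro x hx
    apply hs
    change 2 / r * q x ≤ 1 at hx
    rw [Seminorm.mem_ball_zero]
    rw [div_mul_eq_mul_div, div_le_one hr] at hx
    linarith

end Convex

/-! ### Linear compactness of finite-dimensional spaces -/

section LinearlyCompact

variable {K : Type*} [NormedField K]

theorem IsNonarchConvex.closedBall_subset {C : Set K} (hC : IsNonarchConvex K C) {x y : K}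
    (hx : x ∈ C) (hy : y ∈ C) : Metric.closedBall x (dist x y) ⊆ C := by
  intro z hz
  by_cases hxy : x = y
  · subst hxy
    simp at hz
    rwa [hz]
  · have hne : y - x ≠ 0 := sub_ne_zero.2 (Ne.symm hxy)
    have := hC.add_smul_sub_mem hx hy hx (a := (z - x) / (y - x)) (by
      rw [norm_div, div_le_one (norm_pos_iff.2 hne)]
      rw [mem_closedBall_iff_norm, dist_comm, dist_eq_norm] at hz
      exact hz)
    rwa [smul_eq_mul, div_mul_cancel₀ _ hne, add_sub_cancel] at this

/-- Take `x ∈ C \ D` and `c ∈ D`, with radius `dist c x`. A point of `D` farther from `c` than `x`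
would force `x ∈ D`. -/
theorem IsNonarchConvex.exists_closedBall {C D : Set K} (hC : IsNonarchConvex K C)
    (hD : IsNonarchConvex K D) (hDC : D ⊂ C) :
    ∃ c r, 0 < r ∧ c ∈ D ∧ D ⊆ Metric.closedBall c r ∧ Metric.closedBall c r ⊆ C := by
  obtain ⟨hsub, hne⟩ := Set.ssubset_iff_subset_ne.1 hDC
  obtain ⟨x, hx, hxD⟩ := Set.exists_of_ssubset hDC
  obtain ⟨c, hc⟩ := hD.nonempty
  refine ⟨c, dist c x, dist_pos.2 fun h => hxD (h ▸ hc), hc, ?_, hC.closedBall_subset (hsub hc) hx⟩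
  intro y hy
  by_contra hyc
  rw [Metric.mem_closedBall, not_le, dist_comm y] at hyc
  exact hxD (hD.closedBall_subset hc hy (by
    rw [Metric.mem_closedBall, dist_comm]; exact hyc.le))

variable [IsUltrametricDist K]

/-- Without a least member, every member contains a closed ball that contains another member. Any
two such balls meet, so they are nested according to radius, and a sequence of radii tending to the
infimum reduces to countably many balls. -/
theorem IsSphericallyComplete.iInter_nonempty (hK : IsSphericallyComplete K) {ι : Type*}
    [Nonempty ι] (D : ι → Set K) (hdir : Directed (· ⊇ ·) D)
    (hD : ∀ i, IsNonarchConvex K (D i)) : (⋂ i, D i).Nonempty := by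
  by_cases hmin : ∃ i, ∀ j, D i ⊆ D j
  · obtain ⟨i, hi⟩ := hmin
    exact (hD i).nonempty.mono (Set.subset_iInter hi)
  push Not at hmin
  have key : ∀ i, ∃ j, ∃ c r, 0 < r ∧ c ∈ D j ∧ D j ⊆ Metric.closedBall c r ∧
      Metric.closedBall c r ⊆ D i := by
    intro i
    obtain ⟨j, hj⟩ := hmin i
    obtain ⟨k, hki, hkj⟩ := hdir i j
    obtain ⟨c, r, h⟩ := (hD i).exists_closedBall (hD k)
      (Set.ssubset_iff_subset_ne.2 ⟨hki, fun h => hj (h ▸ hkj)⟩)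
    exact ⟨k, c, r, h⟩
  -- closed balls containing some member of the family
  let R : Set ℝ := {r | 0 < r ∧ ∃ j c, D j ⊆ Metric.closedBall c r}
  have hle : ∀ {c c' r r'}, r ≤ r' → (∃ j, D j ⊆ Metric.closedBall c r) →
      (∃ j, D j ⊆ Metric.closedBall c' r') →
      Metric.closedBall c r ⊆ Metric.closedBall c' r' := by
    rintro c c' r r' hrr ⟨j, hj⟩ ⟨j', hj'⟩
    obtain ⟨k, hk, hk'⟩ := hdir j j'
    obtain ⟨x, hx⟩ := (hD k).nonempty
    have h1 := hj (hk hx)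
    have h2 := hj' (hk' hx)
    rw [IsUltrametricDist.closedBall_eq_of_mem h1, IsUltrametricDist.closedBall_eq_of_mem h2]
    exact Metric.closedBall_subset_closedBall hrr
  have hRne : R.Nonempty := by
    obtain ⟨j, c, r, hr, -, hj, -⟩ := key (Classical.arbitrary ι)
    exact ⟨r, hr, j, c, hj⟩
  have hRbdd : BddBelow R := ⟨0, fun r hr => hr.1.le⟩
  have hglb := isGLB_csInf hRne hRbdd
  by_cases hmem : sInf R ∈ R
  · obtain ⟨hr, j, c, hj⟩ := hmem
    refine ⟨c, Set.mem_iInter.2 fun i => ?_⟩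
    obtain ⟨j', c', r', hr', -, hj', hi⟩ := key i
    exact hi (hle (csInf_le hRbdd ⟨hr', j', c', hj'⟩) ⟨j, hj⟩ ⟨j', hj'⟩
      (Metric.mem_closedBall_self hr.le))
  · obtain ⟨r, hanti, -, htend, hr⟩ := hglb.exists_seq_strictAnti_tendsto_of_notMem hmem hRne
    choose hpos j c hj using hr
    obtain ⟨x, hx⟩ := hK c r hpos fun n =>
      hle (hanti (Nat.lt_succ_self n)).le ⟨_, hj (n + 1)⟩ ⟨_, hj n⟩
    rw [Set.mem_iInter] at hx
    refine ⟨x, Set.mem_iInter.2 fun i => ?_⟩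
    obtain ⟨j', c', r', hr', -, hj', hi⟩ := key i
    have hlt : sInf R < r' := lt_of_le_of_ne (csInf_le hRbdd ⟨hr', j', c', hj'⟩)
      fun h => hmem (h ▸ ⟨hr', j', c', hj'⟩)
    obtain ⟨n, hn⟩ := (htend.eventually_lt_const hlt).exists
    exact hi (hle hn.le ⟨_, hj n⟩ ⟨j', hj'⟩ (hx n))

/-- Induction on the generators: the one-dimensional case applied to the possible coefficients of
`t` fixes `c`, then the slices at `c` lie in the smaller span. The coefficient need not be unique.
-/
theorem IsSphericallyComplete.iInter_nonempty_of_subset_span (hK : IsSphericallyComplete K)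
    {E : Type*} [AddCommGroup E] [Module K E] {ι : Type*} [Nonempty ι] (T : Finset E)
    (D : ι → Set E) (hdir : Directed (· ⊇ ·) D) (hD : ∀ i, IsNonarchConvex K (D i))
    (hT : ∀ i, D i ⊆ Submodule.span K (T : Set E)) : (⋂ i, D i).Nonempty := by
  classical
  induction T using Finset.induction_on generalizing D with
  | empty =>
    refine ⟨0, Set.mem_iInter.2 fun i => ?_⟩
    obtain ⟨x, hx⟩ := (hD i).nonempty
    have := hT i hx
    simp only [Finset.coe_empty, Submodule.span_empty, SetLike.mem_coe, Submodule.mem_bot] at this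
    exact this ▸ hx
  | insert t T _ ih =>
    set S := Submodule.span K (T : Set E)
    obtain ⟨c, hc⟩ := hK.iInter_nonempty (fun i => {c : K | ∃ x ∈ D i, x - c • t ∈ S})
      (hdir.mono_comp (g := fun (X : Set E) => {c : K | ∃ x ∈ X, x - c • t ∈ S}) (· ⊇ ·)
        fun X Y h c ⟨x, hx, hxc⟩ => ⟨x, h hx, hxc⟩) (fun i => by
        refine isNonarchConvex_iff.2 ⟨?_, ?_⟩
        · obtain ⟨x, hx⟩ := (hD i).nonempty
          have := hT i hx
          rw [Finset.coe_insert, SetLike.mem_coe, Submodule.mem_span_insert] at this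
          obtain ⟨a, z, hz, rfl⟩ := this
          exact ⟨a, _, hx, by simpa using hz⟩
        · rintro x ⟨x', hx, hxS⟩ y ⟨y', hy, hyS⟩ z ⟨z', hz, hzS⟩ a ha
          refine ⟨_, (hD i).add_smul_sub_mem hx hy hz ha, ?_⟩
          convert S.add_mem hxS (S.smul_mem a (S.sub_mem hyS hzS)) using 1
          rw [smul_eq_mul]
          module)
    rw [Set.mem_iInter] at hc
    obtain ⟨v, hv⟩ := ih (fun i => {v | v ∈ S ∧ v + c • t ∈ D i})
      (hdir.mono_comp (g := fun (X : Set E) => {v | v ∈ S ∧ v + c • t ∈ X}) (· ⊇ ·)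
        fun X Y h x hx => ⟨hx.1, h hx.2⟩) (fun i => by
        refine isNonarchConvex_iff.2 ⟨?_, ?_⟩
        · obtain ⟨x, hx, hxS⟩ := hc i
          exact ⟨_, hxS, by simpa using hx⟩
        · rintro x ⟨hxS, hx⟩ y ⟨hyS, hy⟩ z ⟨hzS, hz⟩ a ha
          refine ⟨S.add_mem hxS (S.smul_mem a (S.sub_mem hyS hzS)), ?_⟩
          convert (hD i).add_smul_sub_mem hx hy hz ha using 1
          module) (fun i x hx => hx.1)
    rw [Set.mem_iInter] at hv
    exact ⟨v + c • t, Set.mem_iInter.2 fun i => (hv i).2⟩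

end LinearlyCompact

/-! ### Maximal convex filters; local compactoids are c-precompact -/

section Filter

variable {K : Type*} [NormedField K] {E : Type*} [AddCommGroup E] [Module K E]

/-- Membership of a convex set in a maximal convex filter. -/
theorem IsMaximalConvexFilterOn.mem_of_convex {A : Set E} {F : Filter E}
    (hF : IsMaximalConvexFilterOn K A F) {D : Set E} (hD : IsNonarchConvex K D)
    (h : ∀ S ∈ F, (S ∩ D).Nonempty) : D ∈ F := by
  have hF' := hF.prop
  have hconv : IsConvexFilterOn K A (F ⊓ Filter.principal D) := by
    refine ⟨Filter.inf_principal_neBot_iff.2 h, Filter.mem_inf_of_left hF'.mem, ?_⟩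
    intro S hS
    rw [Filter.mem_inf_principal] at hS
    obtain ⟨C, hC, hCS, hCc⟩ := hF'.exists_convex _ hS
    exact ⟨C ∩ D, Filter.inter_mem (Filter.mem_inf_of_left hC)
      (Filter.mem_inf_of_right (Filter.mem_principal_self D)), fun x hx => hCS hx.1 hx.2,
      hCc.inter hD (h C hC)⟩
  exact hF.le_of_le hconv inf_le_left (Filter.mem_inf_of_right (Filter.mem_principal_self D))

/-- Zorn: a set lies in the infimum of a nonempty chain of filters exactly when it lies in some
member, so convex bases survive. -/
theorem IsConvexFilterOn.exists_maximal_le {A : Set E} {F : Filter E}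
    (hF : IsConvexFilterOn K A F) : ∃ M ≤ F, IsMaximalConvexFilterOn K A M := by
  have hchain : ∀ c ⊆ {M : (Filter E)ᵒᵈ | IsConvexFilterOn K A (OrderDual.ofDual M)},
      IsChain (· ≤ ·) c → ∀ y ∈ c, ∃ ub : (Filter E)ᵒᵈ,
        IsConvexFilterOn K A (OrderDual.ofDual ub) ∧ ∀ z ∈ c, z ≤ ub := by
    intro c hc hchain y hy
    let c' : Set (Filter E) := OrderDual.toDual ⁻¹' c
    have hdir : DirectedOn (· ≥ ·) c' := hchain.directedOn
    have hmem : ∀ S : Set E, S ∈ sInf c' ↔ ∃ N ∈ c', S ∈ N := fun S => by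
      rw [sInf_eq_iInf]
      exact Filter.mem_biInf_of_directed (f := id) hdir ⟨_, hy⟩
    refine ⟨OrderDual.toDual (sInf c'), ⟨?_, ?_, ?_⟩,
      fun z hz => sInf_le (a := OrderDual.ofDual z) hz⟩
    · have : Nonempty E := ⟨0⟩
      exact Filter.sInf_neBot_of_directed hdir fun h => (hc h).neBot.ne rfl
    · exact (hmem _).2 ⟨_, hy, (hc hy).mem⟩
    · intro S hS
      obtain ⟨N, hN, hSN⟩ := (hmem _).1 hS
      obtain ⟨C, hC, hCS⟩ := (hc hN).exists_convex S hSN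
      exact ⟨C, (hmem _).2 ⟨N, hN, hC⟩, hCS⟩
  obtain ⟨M, hFM, hM⟩ := zorn_le_nonempty₀ _ hchain (OrderDual.toDual F) hF
  exact ⟨OrderDual.ofDual M, hFM, hM.prop, fun N hN hle => hM.le_of_ge hN hle⟩

theorem cauchy_rightUniformSpace_iff {E : Type*} [AddCommGroup E] [TopologicalSpace E]
    [IsTopologicalAddGroup E] {F : Filter E} :
    @Cauchy E (IsTopologicalAddGroup.rightUniformSpace E) F ↔
      F.NeBot ∧ ∀ U ∈ 𝓝 (0 : E), ∃ S ∈ F, ∀ x ∈ S, ∀ y ∈ S, y - x ∈ U := by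
  let := IsTopologicalAddGroup.rightUniformSpace E
  rw [cauchy_iff]
  refine and_congr_right fun _ => ⟨fun h U hU => ?_, fun h s hs => ?_⟩
  · obtain ⟨S, hS, hSU⟩ := h ((fun p : E × E => p.2 - p.1) ⁻¹' U) (by
      change _ ∈ Filter.comap (fun p : E × E => p.2 + -p.1) (𝓝 0)
      exact ⟨U, hU, fun p hp => by simpa [sub_eq_add_neg] using hp⟩)
    exact ⟨S, hS, fun x hx y hy => hSU (Set.mk_mem_prod hx hy)⟩
  · change _ ∈ Filter.comap (fun p : E × E => p.2 + -p.1) (𝓝 0) at hs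
    obtain ⟨U, hU, hUs⟩ := hs
    obtain ⟨S, hS, hSU⟩ := h U hU
    refine ⟨S, hS, ?_⟩
    rintro ⟨x, y⟩ ⟨hx, hy⟩
    apply hUs
    simpa [sub_eq_add_neg] using hSU x hx y hy

theorem isCPrecompact_of_isLocalCompactoid {K : Type*} [NontriviallyNormedField K]
    [IsUltrametricDist K] (hK : IsSphericallyComplete K)
    {E : Type*} [AddCommGroup E] [Module K E] [TopologicalSpace E] [IsTopologicalAddGroup E]
    {A : Set E} (hA : IsNonarchAbsConvex K A)
    {G : Type*} [AddCommGroup G] [Module K G] [TopologicalSpace G]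
    (hG : IsNonarchLocallyConvex K G) (f : E →ₗ[K] G) (hf : Topology.IsInducing f)
    (hfA : IsLocalCompactoid K (f '' A)) : IsCPrecompact K A := by
  refine ⟨hA, fun F hF => cauchy_rightUniformSpace_iff.2 ⟨hF.prop.neBot, fun U hU => ?_⟩⟩
  rw [hf.nhds_eq_comap, map_zero] at hU
  obtain ⟨V, hV, hVU⟩ := hU
  obtain ⟨q, hqc, hqn, hqV⟩ := hG.exists_seminorm hV
  have hball := isNonarchAbsConvex_seminorm q hqn 1 zero_le_one
  have hballc := hball.isNonarchConvex
  have hqU : {x | q x ≤ 1} ∈ 𝓝 (0 : G) := by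
    have : {x | q x < 1} ∈ 𝓝 (0 : G) :=
      (isOpen_lt hqc continuous_const).mem_nhds (by simp)
    exact Filter.mem_of_superset this fun x (hx : q x < 1) => hx.le
  obtain ⟨T, hT⟩ := hfA.2 _ hqU
  have hsum {x y z : G} {a : K} (ha : ‖a‖ ≤ 1) (hx : q x ≤ 1) (hy : q y ≤ 1) (hz : q z ≤ 1) :
      q (x + a • (y - z)) ≤ 1 :=
    hballc.add_smul_sub_mem (x := x) hx hy hz ha
  set ι := {C : Set E // C ∈ F ∧ C ⊆ A ∧ IsNonarchConvex K C}
  -- Shadows of the filter members on the finite-dimensional span, nonempty because `f '' A` lies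
  -- within the unit ball of that span.
  let D : ι → Set G := fun C => {v | v ∈ Submodule.span K (T : Set G) ∧ ∃ a ∈ C.1, q (f a - v) ≤ 1}
  have hι : ∀ S ∈ F, ∃ C : ι, C.1 ⊆ S := fun S hS => by
    obtain ⟨C, hC, hCS, hCc⟩ := hF.prop.exists_convex _ (Filter.inter_mem hS hF.prop.mem)
    exact ⟨⟨C, hC, fun x hx => (hCS hx).2, hCc⟩, fun x hx => (hCS hx).1⟩
  have : Nonempty ι := ⟨(hι _ hF.prop.mem).choose⟩
  obtain ⟨v, hv⟩ := hK.iInter_nonempty_of_subset_span T D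
    (fun C C' => by
      obtain ⟨C'', h⟩ := hι _ (Filter.inter_mem C.2.1 C'.2.1)
      exact ⟨C'', fun v ⟨hv, a, ha, hav⟩ => ⟨hv, a, (h ha).1, hav⟩,
        fun v ⟨hv, a, ha, hav⟩ => ⟨hv, a, (h ha).2, hav⟩⟩)
    (fun C => by
      refine isNonarchConvex_iff.2 ⟨?_, ?_⟩
      · obtain ⟨a, ha⟩ := C.2.2.2.nonempty
        obtain ⟨u, hu, v, hv, huv⟩ := hT (Set.mem_image_of_mem f (C.2.2.1 ha))
        refine ⟨v, hv, a, ha, ?_⟩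
        rw [← huv]
        simpa using hu
      · rintro x ⟨hxS, x', hx, hxq⟩ y ⟨hyS, y', hy, hyq⟩ z ⟨hzS, z', hz, hzq⟩ a ha
        refine ⟨Submodule.add_mem _ hxS (Submodule.smul_mem _ a (Submodule.sub_mem _ hyS hzS)), _,
          C.2.2.2.add_smul_sub_mem hx hy hz ha, ?_⟩
        convert hsum ha hxq hyq hzq using 2
        simp only [map_add, map_smul, map_sub]
        module)
    (fun C x hx => hx.1)
  rw [Set.mem_iInter] at hv
  -- This convex set meets every member of `F`, so maximality puts it in `F`.
  have hmem : {a | q (f a - v) ≤ 1} ∈ F := by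
    refine hF.mem_of_convex (isNonarchConvex_iff.2 ⟨?_, ?_⟩) fun S hS => ?_
    · obtain ⟨-, a, -, ha⟩ := hv (Classical.arbitrary ι)
      exact ⟨a, ha⟩
    · intro x hx y hy z hz a ha
      have := hsum ha hx hy hz
      simp only [Set.mem_ofPred_eq, map_add, map_smul, map_sub]
      convert this using 2
      module
    · obtain ⟨C, hC⟩ := hι S hS
      obtain ⟨-, a, haC, ha⟩ := hv C
      exact ⟨a, hC haC, ha⟩
  refine ⟨_, hmem, fun x hx y hy => hVU (hqV ?_)⟩
  have := hsum (a := 1) (by simp) (x := 0) (by simp) hy hx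
  simpa using this

end Filter

/-! ### Injectivity of quotients of `K` by balls -/

/-- The unit ball of a non-archimedean field, as a subring. -/
def unitBallSubring (K : Type*) [NormedField K] [IsUltrametricDist K] : Subring K where
  carrier := {a | ‖a‖ ≤ 1}
  mul_mem' {a b} ha hb := by
    simp only [Set.mem_ofPred_eq, norm_mul] at *
    exact mul_le_one₀ ha (norm_nonneg _) hb
  one_mem' := by simp
  add_mem' {a b} ha hb := (IsUltrametricDist.norm_add_le_max a b).trans (max_le ha hb)
  zero_mem' := by simp
  neg_mem' {a} ha := by simpa using ha

section

variable {K : Type*} [NormedField K] [IsUltrametricDist K]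

theorem mem_unitBallSubring {a : K} : a ∈ unitBallSubring K ↔ ‖a‖ ≤ 1 := Iff.rfl

theorem unitBallSubring_smul_def {E : Type*} [AddCommGroup E] [Module K E] (a : unitBallSubring K)
    (x : E) : a • x = (a : K) • x := rfl

/-- An absolutely convex set as a module over the unit ball. -/
def IsNonarchAbsConvex.submodule {E : Type*} [AddCommGroup E] [Module K E] {A : Set E}
    (hA : IsNonarchAbsConvex K A) : Submodule (unitBallSubring K) E where
  carrier := A
  add_mem' {x y} hx hy := hA.add_mem x hx y hy
  zero_mem' := hA.zero_mem
  smul_mem' a x hx := hA.smul_mem a a.2 x hx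

variable (K) in
/-- The closed ball of radius `r` as a module over the unit ball. -/
def closedBallSubmodule (r : ℝ) (hr : 0 ≤ r) : Submodule (unitBallSubring K) K where
  carrier := {a | ‖a‖ ≤ r}
  add_mem' {a b} ha hb := (IsUltrametricDist.norm_add_le_max a b).trans (max_le ha hb)
  zero_mem' := by simpa using hr
  smul_mem' a x hx := by
    simp only [Set.mem_ofPred_eq, unitBallSubring_smul_def, smul_eq_mul, norm_mul] at *
    exact (mul_le_of_le_one_left (norm_nonneg _) a.2).trans hx

/-- Quotients of a spherically complete field by a ball are injective modules over
the unit ball. -/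
theorem IsSphericallyComplete.baer (hK : IsSphericallyComplete K) (r : ℝ) (hr : 0 ≤ r) :
    Module.Baer (unitBallSubring K) (K ⧸ closedBallSubmodule K r hr) := by
  set I := closedBallSubmodule K r hr
  intro J φ
  -- Solutions of the congruence at `j`. Larger `‖j‖` means a stronger condition, so these convex
  -- sets form a chain; multiplication by a common point extends `φ`.
  let D : J → Set K := fun j => {x | I.mkQ ((j : unitBallSubring K) • x) = φ j}
  have hmono : ∀ j j' : J, ‖(j' : K)‖ ≤ ‖(j : K)‖ → D j ⊆ D j' := by
    intro j j' hjj x hx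
    simp only [D, Set.mem_ofPred_eq] at hx ⊢
    obtain ⟨c, hc⟩ : ∃ c : unitBallSubring K, j' = c • j := by
      by_cases hj : (j : K) = 0
      · have : (j' : K) = 0 := by simpa [hj] using hjj
        exact ⟨0, by ext; simpa using this⟩
      · refine ⟨⟨(j' : K) / (j : K), ?_⟩, ?_⟩
        · rw [mem_unitBallSubring, norm_div]
          exact div_le_one_of_le₀ hjj (norm_nonneg _)
        · ext
          simp [hj]
    have h1 : ((c • j : J) : unitBallSubring K) • x = c • (j : unitBallSubring K) • x :=
      mul_smul _ _ _
    rw [hc, h1, map_smul I.mkQ, map_smul φ, hx]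
  obtain ⟨x, hx⟩ := hK.iInter_nonempty D
    (fun j j' => by
      rcases le_total ‖(j : K)‖ ‖(j' : K)‖ with h | h
      · exact ⟨j', hmono _ _ h, subset_rfl⟩
      · exact ⟨j, subset_rfl, hmono _ _ h⟩)
    (fun j => by
      refine isNonarchConvex_iff.2 ⟨?_, ?_⟩
      · by_cases hj : (j : K) = 0
        · refine ⟨0, ?_⟩
          have : j = 0 := by ext; simpa using hj
          simp [D, this]
        · obtain ⟨y, hy⟩ := I.mkQ_surjective (φ j)
          refine ⟨y / (j : K), ?_⟩
          simp only [D, Set.mem_ofPred_eq]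
          rw [unitBallSubring_smul_def, smul_eq_mul, mul_div_cancel₀ _ hj, hy]
      · intro x hx y hy z hz a ha
        simp only [D, Set.mem_ofPred_eq] at *
        obtain ⟨a, rfl⟩ : ∃ b : unitBallSubring K, b = a := ⟨⟨a, ha⟩, rfl⟩
        have : (j : unitBallSubring K) • (x + (a : K) • (y - z)) = (j : unitBallSubring K) • x +
            a • ((j : unitBallSubring K) • y
              - (j : unitBallSubring K) • z) := by
          simp only [unitBallSubring_smul_def, smul_eq_mul]
          ring
        rw [this, map_add I.mkQ, map_smul I.mkQ a, map_sub I.mkQ, hx, hy, hz,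
          sub_self, smul_zero, add_zero])
  rw [Set.mem_iInter] at hx
  exact ⟨I.mkQ ∘ₗ LinearMap.toSpanSingleton (unitBallSubring K) K x, fun b hb => hx ⟨b, hb⟩⟩

end

/-! ### Extending functionals up to an error in a ball -/

section

variable {K : Type*} [NontriviallyNormedField K] [IsUltrametricDist K] [CompleteSpace K]
  {E : Type*} [AddCommGroup E] [Module K E]

/-- A map into `K` that is linear over the unit ball up to an error in a ball is, up to an error in
that ball, a linear functional. -/
theorem exists_linearMap_norm_sub_le (r : ℝ) (s : E → K)
    (hadd : ∀ x y, ‖s (x + y) - (s x + s y)‖ ≤ r)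
    (hsmul : ∀ a : K, ‖a‖ ≤ 1 → ∀ x, ‖s (a • x) - a * s x‖ ≤ r) :
    ∃ g : E →ₗ[K] K, ∀ x, ‖g x - s x‖ ≤ r := by
  obtain ⟨π, hπ0, hπ1⟩ := NormedField.exists_norm_lt_one K
  have hπ : π ≠ 0 := norm_pos_iff.1 hπ0
  have htend : Filter.Tendsto (fun n : ℕ => ‖π‖ ^ n * r) Filter.atTop (𝓝 0) := by
    simpa using (tendsto_pow_atTop_nhds_zero_of_lt_one (norm_nonneg π) hπ1).mul_const r
  -- Rescaling shrinks the linearity errors by `‖π‖ ^ n`, so the limit is exactly linear.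
  let u : ℕ → E → K := fun n x => π ^ n * s ((π ^ n)⁻¹ • x)
  have hcauchy : ∀ x, CauchySeq fun n => u n x := fun x => by
    refine cauchySeq_of_le_geometric ‖π‖ r hπ1 fun n => ?_
    have h := hsmul π hπ1.le ((π ^ (n + 1))⁻¹ • x)
    have h2 : π • (π ^ (n + 1))⁻¹ • x = (π ^ n)⁻¹ • x := by
      rw [smul_smul]
      congr 1
      rw [pow_succ]
      field_simp
    rw [h2] at h
    have h3 : u n x - u (n + 1) x
        = π ^ n * (s ((π ^ n)⁻¹ • x) - π * s ((π ^ (n + 1))⁻¹ • x)) := by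
      simp only [u]
      ring
    rw [dist_eq_norm, h3, norm_mul, norm_pow, mul_comm]
    exact mul_le_mul_of_nonneg_right h (by positivity)
  choose g hg using fun x => cauchySeq_tendsto_of_complete (hcauchy x)
  have hzero : ∀ (v : ℕ → K) (l : K), (∀ n, ‖v n‖ ≤ ‖π‖ ^ n * r) →
      Filter.Tendsto v Filter.atTop (𝓝 l) → l = 0 := fun v l hv hl =>
    tendsto_nhds_unique hl (squeeze_zero_norm hv htend)
  have hgadd : ∀ x y, g (x + y) = g x + g y := fun x y => by
    refine sub_eq_zero.1 (hzero _ _ (fun n => ?_) ((hg (x + y)).sub ((hg x).add (hg y))))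
    have : u n (x + y) - (u n x + u n y) = π ^ n * (s ((π ^ n)⁻¹ • x + (π ^ n)⁻¹ • y)
        - (s ((π ^ n)⁻¹ • x) + s ((π ^ n)⁻¹ • y))) := by
      simp only [u, smul_add]
      ring
    rw [this, norm_mul, norm_pow]
    exact mul_le_mul_of_nonneg_left (hadd _ _) (by positivity)
  have hgsmul : ∀ a : K, ‖a‖ ≤ 1 → ∀ x, g (a • x) = a * g x := fun a ha x => by
    refine sub_eq_zero.1 (hzero _ _ (fun n => ?_) ((hg (a • x)).sub ((hg x).const_mul a)))
    have : u n (a • x) - a * u n x = π ^ n * (s (a • (π ^ n)⁻¹ • x)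
        - a * s ((π ^ n)⁻¹ • x)) := by
      simp only [u, smul_comm a]
      ring
    rw [this, norm_mul, norm_pow]
    exact mul_le_mul_of_nonneg_left (hsmul a ha _) (by positivity)
  refine ⟨{ toFun := g, map_add' := hgadd, map_smul' := fun a x => ?_ }, fun x => ?_⟩
  · rcases le_or_gt ‖a‖ 1 with ha | ha
    · exact hgsmul a ha x
    · have ha0 : a ≠ 0 := norm_pos_iff.1 (zero_lt_one.trans ha)
      have := hgsmul a⁻¹ (by rw [norm_inv]; exact inv_le_one_of_one_le₀ ha.le) (a • x)
      rw [inv_smul_smul₀ ha0] at this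
      rw [this, RingHom.id_apply, smul_eq_mul, mul_inv_cancel_left₀ ha0]
  · refine le_of_tendsto ((hg x).sub_const (s x)).norm (Filter.Eventually.of_forall fun n => ?_)
    have := hsmul (π ^ n) (by rw [norm_pow]; exact pow_le_one₀ (norm_nonneg _) hπ1.le)
      ((π ^ n)⁻¹ • x)
    rw [smul_inv_smul₀ (pow_ne_zero n hπ), norm_sub_rev] at this
    exact this

/-- Extension of functionals modulo a ball. -/
theorem IsSphericallyComplete.exists_linearMap (hK : IsSphericallyComplete K)
    {r : ℝ} (hr : 0 ≤ r) (U : Submodule (unitBallSubring K) E)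
    {X : Type*} [AddCommGroup X] [Module (unitBallSubring K) X]
    (L : X →ₗ[unitBallSubring K] E) (γ : X →ₗ[unitBallSubring K] K)
    (h : ∀ x, L x ∈ U → ‖γ x‖ ≤ r) :
    ∃ g : E →ₗ[K] K, (∀ x, ‖g (L x) - γ x‖ ≤ r) ∧ ∀ x ∈ U, ‖g x‖ ≤ r := by
  set I := closedBallSubmodule K r hr
  let L' := U.mkQ ∘ₗ L
  have hker : LinearMap.ker L' ≤ LinearMap.ker (I.mkQ ∘ₗ γ) := by
    intro x hx
    simp only [L', LinearMap.mem_ker, LinearMap.comp_apply, Submodule.mkQ_apply,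
      Submodule.Quotient.mk_eq_zero] at hx ⊢
    exact h x hx
  obtain ⟨ψ, hψ⟩ := (hK.baer r hr).extension_property ((LinearMap.ker L').liftQ L' le_rfl)
    (LinearMap.ker_eq_bot.1 (Submodule.ker_liftQ_eq_bot _ _ _ le_rfl))
    ((LinearMap.ker L').liftQ _ hker)
  have hψ' : ∀ x, ψ (U.mkQ (L x)) = I.mkQ (γ x) := fun x =>
    LinearMap.congr_fun hψ ((LinearMap.ker L').mkQ x)
  -- An arbitrary lift of `ψ` to `K` is linear up to the ball, which is all the straightening lemma
  -- needs.
  choose s hs using fun x => I.mkQ_surjective (ψ (U.mkQ x))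
  have hI : ∀ a b : K, I.mkQ a = I.mkQ b → ‖a - b‖ ≤ r := fun a b hab =>
    (Submodule.Quotient.eq I).1 hab
  obtain ⟨g, hg⟩ := exists_linearMap_norm_sub_le r s
    (fun x y => hI _ _ (by simp only [map_add, hs]))
    (fun a ha x => hI _ _ (by
      have h1 : a * s x = (⟨a, ha⟩ : unitBallSubring K) • s x := rfl
      have h2 : a • x = (⟨a, ha⟩ : unitBallSubring K) • x := rfl
      rw [h1, h2, hs, map_smul, map_smul, map_smul, hs]))
  have hsum : ∀ a b : K, ‖a‖ ≤ r → ‖b‖ ≤ r → ‖a + b‖ ≤ r := fun a b ha hb =>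
    (IsUltrametricDist.norm_add_le_max a b).trans (max_le ha hb)
  refine ⟨g, fun x => ?_, fun x hx => ?_⟩
  · have := hsum _ _ (hg (L x)) (hI (s (L x)) (γ x) (by rw [hs, hψ']))
    simpa using this
  · have h0 : U.mkQ x = 0 := (Submodule.Quotient.mk_eq_zero U).2 hx
    have := hsum _ _ (hg x) (hI (s x) 0 (by rw [hs, h0, map_zero, map_zero]))
    simpa using this

end

/-! ### Independence modulo a seminorm ball -/

section Independence

variable {K : Type*} [NormedField K] [IsUltrametricDist K] {E : Type*} [AddCommGroup E] [Module K E]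

variable (K) in
/-- Coefficient systems supported in `s` with values in the unit ball. -/
def unitBallFinsupp (s : Set E) : Submodule (unitBallSubring K) (E →₀ K) where
  carrier := {c | (∀ x ∉ s, c x = 0) ∧ ∀ x, ‖c x‖ ≤ 1}
  add_mem' {c d} hc hd := ⟨fun x hx => by simp [hc.1 x hx, hd.1 x hx], fun x =>
    (IsUltrametricDist.norm_add_le_max _ _).trans (max_le (hc.2 x) (hd.2 x))⟩
  zero_mem' := by simp
  smul_mem' a c hc := ⟨fun x hx => by simp [unitBallSubring_smul_def, hc.1 x hx], fun x => by
    rw [Finsupp.smul_apply, unitBallSubring_smul_def, smul_eq_mul, norm_mul]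
    exact mul_le_one₀ a.2 (norm_nonneg _) (hc.2 x)⟩

/-- The vectors in `s` generate nonzero cyclic modules modulo the unit ball of `p`, and these
are independent. -/
structure IsIndepMod (p : Seminorm K E) (s : Set E) : Prop where
  one_lt : ∀ x ∈ s, 1 < p x
  smul_le_one : ∀ c ∈ unitBallFinsupp K s, p (Finsupp.linearCombination K id c) ≤ 1 →
    ∀ x, p (c x • x) ≤ 1

/-- Zorn applies because a relation has finite support, hence lives in one member of a chain. -/
theorem exists_maximal_isIndepMod (p : Seminorm K E) (A : Set E) :
    ∃ s, Maximal (fun s => s ⊆ A ∧ IsIndepMod p s) s := by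
  refine zorn_subset {s | s ⊆ A ∧ IsIndepMod p s} fun C hC hchain => ?_
  refine ⟨⋃₀ C, ⟨Set.sUnion_subset fun s hs => (hC hs).1, ?_, ?_⟩,
    fun s hs => Set.subset_sUnion_of_mem hs⟩
  · rintro x ⟨s, hs, hx⟩
    exact (hC hs).2.one_lt x hx
  · intro c hc hle x
    by_cases hc0 : c = 0
    · simp [hc0]
    have hsub : (c.support : Set E) ⊆ ⋃₀ C := fun y hy => by
      by_contra hyC
      exact (Finsupp.mem_support_iff.1 hy) (hc.1 y hyC)
    obtain ⟨y, hy⟩ := Finsupp.support_nonempty_iff.2 hc0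
    obtain ⟨t, ht, -⟩ := hsub hy
    obtain ⟨s, hs, hcs⟩ := hchain.directedOn.exists_mem_subset_of_finset_subset_biUnion ⟨t, ht⟩
      (f := id) (s := c.support) (by simpa [Set.sUnion_eq_biUnion] using hsub)
    refine (hC hs).2.smul_le_one c ⟨fun z hz => ?_, hc.2⟩ hle x
    by_contra hcz
    exact hz (hcs (Finsupp.mem_support_iff.2 hcz))

/-- A maximal independent set modulo the unit ball of `p` is essential. -/
theorem exists_smul_sub_linearCombination {p : Seminorm K E} (hp : IsNonarchimedean (p : E → ℝ))
    {A s : Set E} (hs : Maximal (fun s => s ⊆ A ∧ IsIndepMod p s) s) {a : E} (ha : a ∈ A)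
    (hpa : 1 < p a) :
    ∃ b : K, ‖b‖ ≤ 1 ∧ 1 < p (b • a) ∧ ∃ c ∈ unitBallFinsupp K s,
      p (b • a - Finsupp.linearCombination K id c) ≤ 1 := by
  classical
  by_cases has : a ∈ s
  · refine ⟨1, by simp, by simpa using hpa, Finsupp.single a 1, ⟨?_, ?_⟩, by simp⟩
    · intro x hx
      exact Finsupp.single_eq_of_ne fun h => hx (h ▸ has)
    · intro x
      rw [Finsupp.single_apply]
      split_ifs <;> simp
  -- Maximality yields a bad relation on `insert a s`. Its term at `a` must leave the unit ball, as
  -- otherwise erasing it gives a bad relation on `s`.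
  have hnot : ¬ IsIndepMod p (insert a s) := fun h =>
    has (hs.le_of_ge ⟨Set.insert_subset ha hs.prop.1, h⟩ (Set.subset_insert a s)
      (Set.mem_insert a s))
  obtain ⟨c, hc, hle, x, hx⟩ : ∃ c ∈ unitBallFinsupp K (insert a s),
      p (Finsupp.linearCombination K id c) ≤ 1 ∧ ∃ x, 1 < p (c x • x) := by
    by_contra! hcon
    refine hnot ⟨?_, hcon⟩
    rintro x (rfl | hx)
    · exact hpa
    · exact hs.prop.2.one_lt x hx
  have hdec : Finsupp.linearCombination K id c
      = c a • a + Finsupp.linearCombination K id (c.erase a) := by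
    conv_lhs => rw [← Finsupp.single_add_erase a c]
    rw [map_add, Finsupp.linearCombination_single, id]
  have herase : c.erase a ∈ unitBallFinsupp K s := by
    refine ⟨fun y hy => ?_, fun y => ?_⟩
    · rw [Finsupp.erase_apply]
      split_ifs with h
      · rfl
      · exact hc.1 y (by simp [h, hy])
    · rw [Finsupp.erase_apply]
      split_ifs with h
      · simp
      · exact hc.2 y
  refine ⟨c a, hc.2 a, ?_, -c.erase a, neg_mem herase, ?_⟩
  · by_contra! hca
    have h1 : p (Finsupp.linearCombination K id (c.erase a)) ≤ 1 := by
      have := hp.seminorm_sub_le hle hca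
      rwa [hdec, add_sub_cancel_left] at this
    have h2 := hs.prop.2.smul_le_one _ herase h1 x
    rw [Finsupp.erase_apply] at h2
    split_ifs at h2 with h
    · subst h
      exact hx.not_ge hca
    · exact hx.not_ge h2
  · rwa [map_neg, sub_neg_eq_add, ← hdec]

theorem IsCPrecompact.finite_of_isIndepMod {K : Type*} [NontriviallyNormedField K]
    [IsUltrametricDist K] {E : Type*} [AddCommGroup E] [Module K E] [TopologicalSpace E]
    [IsTopologicalAddGroup E] {A : Set E} (hA : IsCPrecompact K A) {p : Seminorm K E}
    (hpc : Continuous p) (hp : IsNonarchimedean (p : E → ℝ)) {s : Set E} (hsA : s ⊆ A)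
    (hs : IsIndepMod p s) : s.Finite := by
  classical
  by_contra hinf
  let e := Set.Infinite.natEmbedding s hinf
  let a : ℕ → E := fun n => e n
  have ha : Function.Injective a := Subtype.val_injective.comp e.injective
  have has : ∀ n, a n ∈ s := fun n => (e n).2
  let L : (ℕ →₀ K) →ₗ[K] E := Finsupp.linearCombination K a
  have hindep : ∀ c : ℕ →₀ K, (∀ i, ‖c i‖ ≤ 1) → p (L c) ≤ 1 → ∀ i, p (c i • a i) ≤ 1 := by
    intro c hc hle i
    have := hs.smul_le_one (c.mapDomain a) ⟨fun x hx => ?_, fun x => ?_⟩ ?_ (a i)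
    · rwa [Finsupp.mapDomain_apply ha] at this
    · exact Finsupp.mapDomain_of_notMem_range _ _ fun ⟨i, hi⟩ => hx (hi ▸ has i)
    · by_cases hx : x ∈ Set.range a
      · obtain ⟨i, rfl⟩ := hx
        rw [Finsupp.mapDomain_apply ha]
        exact hc i
      · rw [Finsupp.mapDomain_of_notMem_range _ _ hx]
        simp
    · rw [Finsupp.linearCombination_mapDomain]
      exact hle
  have hball := (isNonarchAbsConvex_seminorm p hp 1 zero_le_one).isNonarchConvex
  -- Elements of `A` congruent to a combination whose first `N` coefficients are 1: no finite
  -- combination can lie close to all these sets.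
  let D : ℕ → Set E := fun N => {x | x ∈ A ∧ ∃ c : ℕ →₀ K, (∀ i, ‖c i‖ ≤ 1) ∧
    (∀ i < N, c i = 1) ∧ p (x - L c) ≤ 1}
  have hDanti : Antitone D := fun M N hMN x ⟨hx, c, hc, hc1, hcx⟩ =>
    ⟨hx, c, hc, fun i hi => hc1 i (hi.trans_le hMN), hcx⟩
  have hDconv : ∀ N, IsNonarchConvex K (D N) := by
    intro N
    refine isNonarchConvex_iff.2 ⟨?_, ?_⟩
    · let c : ℕ →₀ K := Finsupp.indicator (Finset.range N) fun _ _ => 1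
      have hLc : L c = ∑ i ∈ Finset.range N, a i := by
        simp only [L, c, Finsupp.linearCombination_apply]
        rw [Finsupp.sum_of_support_subset (s := Finset.range N) _
          (Finsupp.support_indicator_subset _ _) _ (by simp)]
        refine Finset.sum_congr rfl fun i hi => ?_
        rw [Finsupp.indicator_of_mem hi, one_smul]
      refine ⟨L c, ?_, c, fun i => ?_, fun i hi => ?_, by simp⟩
      · rw [hLc]
        exact hA.1.submodule.sum_mem fun i _ => hsA (has i)
      · rw [Finsupp.indicator_apply]
        split_ifs <;> simp
      · exact Finsupp.indicator_of_mem (Finset.mem_range.2 hi) _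
    · rintro x ⟨hx, c, hc, hc1, hcx⟩ y ⟨hy, d, hd, hd1, hdy⟩ z ⟨hz, e, he, he1, hez⟩ b hb
      refine ⟨hA.1.isNonarchConvex.add_smul_sub_mem hx hy hz hb, c + b • (d - e), fun i => ?_,
        fun i hi => ?_, ?_⟩
      · exact (isNonarchAbsConvex_seminorm (normSeminorm K K) IsUltrametricDist.isNonarchimedean_norm
          1 zero_le_one).isNonarchConvex.add_smul_sub_mem (hc i) (hd i) (he i) hb
      · simp [hc1 i hi, hd1 i hi, he1 i hi]
      · have := hball.add_smul_sub_mem (x := x - L c) hcx hdy hez hb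
        have heq : x + b • (y - z) - L (c + b • (d - e))
            = x - L c + b • (y - L d - (z - L e)) := by
          simp only [map_add, map_smul, map_sub]
          module
        rw [heq]
        exact this
  have hbasis := Filter.hasBasis_iInf_principal (s := D) hDanti.directed_ge
  have hF : IsConvexFilterOn K A (⨅ N, Filter.principal (D N)) := by
    refine ⟨hbasis.neBot_iff.2 fun _ => (hDconv _).nonempty,
      hbasis.mem_of_superset (i := 0) trivial fun x hx => hx.1, fun S hS => ?_⟩
    obtain ⟨N, -, hN⟩ := hbasis.mem_iff.1 hS
    exact ⟨D N, hbasis.mem_of_mem trivial, hN, hDconv N⟩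
  obtain ⟨F, hFle, hFmax⟩ := hF.exists_maximal_le
  obtain ⟨hne, hcau⟩ := cauchy_rightUniformSpace_iff.1 (hA.2 F hFmax)
  obtain ⟨S, hS, hSp⟩ := hcau {x | p x ≤ 1} (by
    have : {x | p x < 1} ∈ 𝓝 (0 : E) :=
      (isOpen_lt hpc continuous_const).mem_nhds (by simp)
    exact Filter.mem_of_superset this fun x (hx : p x < 1) => hx.le)
  have hmeet : ∀ N, (S ∩ D N).Nonempty := fun N =>
    hne.nonempty_of_mem (Filter.inter_mem hS (hFle (hbasis.mem_of_mem trivial)))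
  obtain ⟨x, hxS, -, c, hc, -, hcx⟩ := hmeet 0
  -- At `m` the coefficient of `c` is 0, while that of `d`, taken from `D (m + 1)`, is 1.
  -- Independence then gives `p (a m) ≤ 1`.
  obtain ⟨m, hm⟩ := Infinite.exists_notMem_finset c.support
  obtain ⟨y, hyS, -, d, hd, hd1, hdy⟩ := hmeet (m + 1)
  have hdc : p (L (d - c)) ≤ 1 := by
    have := hp.seminorm_sub_le (hp.seminorm_sub_le (hSp x hxS y hyS) hdy)
      (hp.seminorm_sub_le (x := 0) (by simp) hcx)
    convert this using 2
    rw [map_sub]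
    abel
  have hle := hindep (d - c) (fun i => by
    rw [Finsupp.sub_apply, sub_eq_add_neg]
    exact (IsUltrametricDist.norm_add_le_max _ _).trans (max_le (hd i) (by simpa using hc i)))
    hdc m
  rw [Finsupp.sub_apply, hd1 m (Nat.lt_succ_self m), Finsupp.notMem_support_iff.1 hm, sub_zero,
    one_smul] at hle
  exact (hs.one_lt _ (has m)).not_ge hle

end Independence

/-! ### Approximating functionals on a c-precompact set -/

section Approximation

variable {K : Type*} [NontriviallyNormedField K] [IsUltrametricDist K] [CompleteSpace K]
  {E : Type*} [AddCommGroup E] [Module K E]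

/-- On a c-precompact set, finitely many functionals detect the unit ball of a continuous
non-archimedean seminorm. -/
theorem IsCPrecompact.exists_functionals (hK : IsSphericallyComplete K) [TopologicalSpace E]
    [IsTopologicalAddGroup E] {A : Set E} (hA : IsCPrecompact K A) {p : Seminorm K E}
    (hpc : Continuous p) (hp : IsNonarchimedean (p : E → ℝ)) :
    ∃ (s : Finset E) (g : s → E →ₗ[K] K), (∀ x ∈ s, 1 < p x) ∧
      ∀ a ∈ A, (∀ x : s, ‖g x a‖ ≤ (p x)⁻¹) → p a ≤ 1 := by
  obtain ⟨s, hs⟩ := exists_maximal_isIndepMod p A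
  have hfin := hA.finite_of_isIndepMod hpc hp hs.prop.1 hs.prop.2
  lift s to Finset E using hfin
  have hball := isNonarchAbsConvex_seminorm p hp 1 zero_le_one
  let L : unitBallFinsupp K (s : Set E) →ₗ[unitBallSubring K] E :=
    (Finsupp.linearCombination K (id : E → E)).restrictScalars (unitBallSubring K) ∘ₗ
      (unitBallFinsupp K (s : Set E)).subtype
  have hpos : ∀ x ∈ s, 0 < p x := fun x hx => zero_lt_one.trans (hs.prop.2.one_lt x hx)
  let γ : s → unitBallFinsupp K (s : Set E) →ₗ[unitBallSubring K] K := fun x =>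
    (Finsupp.lapply (R := K) (x : E)).restrictScalars (unitBallSubring K) ∘ₗ
      (unitBallFinsupp K (s : Set E)).subtype
  -- The radius is forced: `p (c • x) ≤ 1` means `‖c‖ ≤ (p x)⁻¹`.
  have hex : ∀ x : s, ∃ g : E →ₗ[K] K, (∀ c, ‖g (L c) - γ x c‖ ≤ (p x)⁻¹) ∧
      ∀ y ∈ hball.submodule, ‖g y‖ ≤ (p x)⁻¹ := fun x =>
    hK.exists_linearMap (X := unitBallFinsupp K (s : Set E)) (inv_nonneg.2 (apply_nonneg p x.1))
      hball.submodule L (γ x) fun (c : unitBallFinsupp K (s : Set E)) hc => by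
      have := hs.prop.2.smul_le_one c.1 c.2 hc x
      rw [map_smul_eq_mul] at this
      rw [← one_div, le_div_iff₀ (hpos x x.2)]
      exact this
  choose g hgL hgU using hex
  refine ⟨s, g, hs.prop.2.one_lt, fun a ha hga => ?_⟩
  -- Essentiality gives a multiple `b • a` outside the ball and congruent to a combination, so some
  -- coefficient exceeds `(p x)⁻¹`; but `g x` recovers it up to that error, and `g x (b • a)` is
  -- that small.
  by_contra! hpa
  obtain ⟨b, hb, hba, c, hc, hbc⟩ := exists_smul_sub_linearCombination hp hs ha hpa
  obtain ⟨x, hx⟩ : ∃ x, 1 < p (c x • x) := by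
    by_contra! hcon
    have h1 : Finsupp.linearCombination K id c ∈ hball.submodule := by
      rw [Finsupp.linearCombination_apply]
      exact sum_mem fun x _ => hcon x
    have := hp.seminorm_sub_le hbc (hp.seminorm_sub_le (x := 0) (by simp) h1)
    simp only [zero_sub, sub_neg_eq_add, sub_add_cancel] at this
    exact hba.not_ge this
  have hxs : x ∈ s := by
    by_contra hxs
    rw [hc.1 x hxs] at hx
    simp at hx
    linarith
  have h1 := hgL ⟨x, hxs⟩ ⟨c, hc⟩
  have h2 := hgU ⟨x, hxs⟩ _ hbc
  have h3 : ‖g ⟨x, hxs⟩ (b • a)‖ ≤ (p x)⁻¹ := by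
    rw [map_smul, smul_eq_mul, norm_mul]
    exact (mul_le_of_le_one_left (norm_nonneg _) hb).trans (hga ⟨x, hxs⟩)
  have h4 : ‖c x‖ ≤ (p x)⁻¹ := by
    have hsub : ∀ u v : K, ‖u‖ ≤ (p x)⁻¹ → ‖v‖ ≤ (p x)⁻¹ → ‖u - v‖ ≤ (p x)⁻¹ := fun u v hu hv => by
      rw [sub_eq_add_neg]
      exact (IsUltrametricDist.norm_add_le_max _ _).trans (max_le hu (by rwa [norm_neg]))
    have := hsub _ _ (hsub _ _ h3 h2) h1
    convert this using 2
    rw [map_sub]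
    change c x = _ - (_ - _) - (g ⟨x, hxs⟩ (Finsupp.linearCombination K id c) - c x)
    ring
  rw [map_smul_eq_mul, ← div_lt_iff₀ (hpos x hxs), one_div] at hx
  exact hx.not_ge h4

/-- Functionals that are bounded by `1` on `A ∩ {p ≤ 1}` are uniformly approximated on a
c-precompact set `A` by combinations of finitely many functionals, with bounded coefficients. -/
theorem IsCPrecompact.exists_approximation (hK : IsSphericallyComplete K) [TopologicalSpace E]
    [IsTopologicalAddGroup E] {A : Set E} (hA : IsCPrecompact K A) {p : Seminorm K E}
    (hpc : Continuous p) (hp : IsNonarchimedean (p : E → ℝ)) :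
    ∃ (s : Finset E) (g : s → E →ₗ[K] K) (C : ℝ), ∀ γ : E →ₗ[K] K,
      (∀ a, p a ≤ 1 → ‖γ a‖ ≤ 1) → ∃ c : s → K, (∀ x, ‖c x‖ ≤ C) ∧
        ∀ a ∈ A, ‖γ a - ∑ x, g x a * c x‖ ≤ 1 := by
  classical
  obtain ⟨s, g, hs, hg⟩ := hA.exists_functionals hK hpc hp
  have hnn : 0 ≤ ∑ x ∈ s, p x := Finset.sum_nonneg fun x _ => apply_nonneg p x
  -- `‖μ‖` lies below every `(p x)⁻¹`, so each `Pi.single x μ` lies in `U`; this bounds the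
  -- coefficients by `‖μ‖⁻¹`, independently of `γ`.
  obtain ⟨μ, hμ0, hμ⟩ := NormedField.exists_norm_lt K (r := (1 + ∑ x ∈ s, p x)⁻¹) (by positivity)
  let U : Submodule (unitBallSubring K) (s → K) :=
    Submodule.pi Set.univ fun x => closedBallSubmodule K (p x)⁻¹ (inv_nonneg.2 (apply_nonneg p _))
  refine ⟨s, g, ‖μ‖⁻¹, fun γ hγ => ?_⟩
  obtain ⟨G, hGL, hGU⟩ := hK.exists_linearMap zero_le_one U
    ((LinearMap.pi g).restrictScalars (unitBallSubring K) ∘ₗ hA.1.submodule.subtype)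
    (γ.restrictScalars (unitBallSubring K) ∘ₗ hA.1.submodule.subtype) fun a ha =>
      hγ _ (hg a a.2 fun x => ha x (Set.mem_univ _))
  refine ⟨fun x => G (Pi.single x 1), fun x => ?_, fun a ha => ?_⟩
  · have hmem : (Pi.single x μ : s → K) ∈ U := by
      intro y _
      change ‖(Pi.single x μ : s → K) y‖ ≤ (p y)⁻¹
      by_cases hyx : y = x
      · subst hyx
        rw [Pi.single_eq_same]
        refine hμ.le.trans (inv_anti₀ (zero_lt_one.trans (hs y y.2)) ?_)
        have := Finset.single_le_sum (f := fun x => p x) (fun x _ => apply_nonneg p x) y.2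
        linarith
      · rw [Pi.single_eq_of_ne hyx, norm_zero]
        exact inv_nonneg.2 (apply_nonneg p _)
    have h1 := hGU _ hmem
    have h2 : (Pi.single x μ : s → K) = μ • Pi.single x 1 := by
      rw [← Pi.single_smul, smul_eq_mul, mul_one]
    rw [h2, map_smul, smul_eq_mul, norm_mul] at h1
    rw [← one_div, le_div_iff₀ hμ0, mul_comm]
    exact h1
  · have h1 := hGL ⟨a, ha⟩
    have h2 : G (fun x => g x a) = ∑ x, g x a * G (Pi.single x 1) := by
      rw [LinearMap.pi_apply_eq_sum_univ G]
      refine Finset.sum_congr rfl fun x _ => ?_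
      rw [smul_eq_mul]
      congr 2
      ext y
      simp [Pi.single_apply, eq_comm]
    rw [norm_sub_rev, ← h2]
    exact h1

end Approximation

/-! ### Evaluation into bounded functions on dual balls -/

section Evaluation

open scoped ENNReal

variable {K : Type*} [NontriviallyNormedField K] {E : Type*} [AddCommGroup E] [Module K E]

/-- The functionals bounded by `1` on the unit ball of `p`. -/
def dualBall (p : Seminorm K E) : Set (E →ₗ[K] K) := {g | ∀ y, p y ≤ 1 → ‖g y‖ ≤ 1}

/-- Rescale by `a⁻¹`. The comparison is with `‖a‖` because `p y` need not be a value of the norm. -/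
theorem norm_le_of_mem_dualBall {p : Seminorm K E} {g : E →ₗ[K] K} (hg : g ∈ dualBall p) {a : K}
    (ha : 0 < ‖a‖) {y : E} (hy : p y ≤ ‖a‖) : ‖g y‖ ≤ ‖a‖ := by
  have := hg (a⁻¹ • y) (by
    rw [map_smul_eq_mul, norm_inv, inv_mul_le_one₀ ha]
    exact hy)
  rwa [map_smul, smul_eq_mul, norm_mul, norm_inv, inv_mul_le_one₀ ha] at this

theorem memℓp_eval_dualBall (p : Seminorm K E) (x : E) :
    Memℓp (fun g : dualBall p => (g : E →ₗ[K] K) x) ∞ := by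
  obtain ⟨a, ha⟩ := NormedField.exists_lt_norm K (p x)
  refine memℓp_infty ⟨‖a‖, ?_⟩
  rintro _ ⟨g, rfl⟩
  exact norm_le_of_mem_dualBall g.2 ((apply_nonneg p x).trans_lt ha) ha.le

/-- Evaluation, as a map into the bounded functions on the dual ball of `p`. -/
def evalDualBall (p : Seminorm K E) : E →ₗ[K] lp (fun _ : dualBall p => K) ∞ where
  toFun x := ⟨_, memℓp_eval_dualBall p x⟩
  map_add' x y := by
    ext g
    exact map_add g.1 x y
  map_smul' a x := by
    ext g
    exact map_smul g.1 a x

theorem norm_evalDualBall_le (p : Seminorm K E) {a : K} (ha : 0 < ‖a‖) {x : E} (hx : p x ≤ ‖a‖) :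
    ‖evalDualBall p x‖ ≤ ‖a‖ :=
  lp.norm_le_of_forall_le ha.le fun g => norm_le_of_mem_dualBall g.2 ha hx

/-- Hahn–Banach for non-archimedean seminorms over a spherically complete field. -/
theorem IsSphericallyComplete.exists_mem_dualBall [IsUltrametricDist K] [CompleteSpace K]
    (hK : IsSphericallyComplete K) {p : Seminorm K E} (hp : IsNonarchimedean (p : E → ℝ)) {x : E}
    (hx : 1 < p x) : ∃ g ∈ dualBall p, 1 ≤ ‖g x‖ := by
  have hpos := zero_lt_one.trans hx
  -- Extend `b • x ↦ b` up to error `(p x)⁻¹ < 1`; then `g x` is too close to 1 to have norm below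
  -- 1.
  obtain ⟨g, hg, hgU⟩ := hK.exists_linearMap (inv_nonneg.2 hpos.le)
    (isNonarchAbsConvex_seminorm p hp 1 zero_le_one).submodule
    (LinearMap.toSpanSingleton (unitBallSubring K) E x)
    (Algebra.linearMap (unitBallSubring K) K) fun b hb => by
      change p ((b : K) • x) ≤ 1 at hb
      rw [map_smul_eq_mul] at hb
      rw [← one_div, le_div_iff₀ hpos]
      exact hb
  have hlt : (p x)⁻¹ < 1 := inv_lt_one_of_one_lt₀ hx
  refine ⟨g, fun y hy => (hgU y hy).trans hlt.le, ?_⟩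
  have h1 := hg 1
  rw [LinearMap.toSpanSingleton_apply, one_smul] at h1
  by_contra! hcon
  have h2 := IsUltrametricDist.norm_add_le_max (g x) (-(g x - 1))
  rw [neg_sub, add_sub_cancel, norm_one, norm_sub_rev] at h2
  have h3 : ‖g x - 1‖ ≤ (p x)⁻¹ := by simpa using h1
  exact (max_lt hcon (h3.trans_lt hlt)).not_ge h2

variable (K E) in
/-- The continuous non-archimedean seminorms. -/
abbrev ContNonarchSeminorm [TopologicalSpace E] :=
  {p : Seminorm K E // Continuous p ∧ IsNonarchimedean (p : E → ℝ)}

variable (K E) in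
/-- The product, over all continuous non-archimedean seminorms, of the spaces of bounded functions
on their dual balls. -/
abbrev BoundedDual [TopologicalSpace E] :=
  ∀ p : ContNonarchSeminorm K E, lp (fun _ : dualBall p.1 => K) ∞

variable (K E) in
/-- The evaluation map. -/
noncomputable def evalBoundedDual [TopologicalSpace E] : E →ₗ[K] BoundedDual K E :=
  LinearMap.pi fun p => evalDualBall p.1

theorem isNonarchLocallyConvex_of_family {ι : Type*} [TopologicalSpace E]
    [IsTopologicalAddGroup E] {q : SeminormFamily K E ι} (hq : WithSeminorms q)
    (hna : ∀ i, IsNonarchimedean (q i : E → ℝ)) : IsNonarchLocallyConvex K E := by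
  refine ⟨Set.range q, ?_, ?_⟩
  · rintro _ ⟨i, rfl⟩
    exact hna i
  · rw [SeminormFamily.withSeminorms_iff_nhds_eq_iInf] at hq ⊢
    rw [hq]
    exact (iInf_range' (fun p : Seminorm K E => (𝓝 (0 : ℝ)).comap p) q).symm

theorem isNonarchLocallyConvex_boundedDual [IsUltrametricDist K] [TopologicalSpace E] :
    IsNonarchLocallyConvex K (BoundedDual K E) := by
  refine isNonarchLocallyConvex_of_family (q := fun p : ContNonarchSeminorm K E =>
    (normSeminorm K (lp (fun _ : dualBall p.1 => K) ∞)).comp (LinearMap.proj p)) ?_ ?_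
  · rw [SeminormFamily.withSeminorms_iff_nhds_eq_iInf, nhds_pi, Filter.pi]
    refine iInf_congr fun p => ?_
    rw [Pi.zero_apply, ← comap_norm_nhds_zero, Filter.comap_comap]
    rfl
  · intro p h h'
    refine lp.norm_le_of_forall_le (le_max_of_le_left (apply_nonneg _ _)) fun g => ?_
    exact (IsUltrametricDist.norm_add_le_max (h p g) (h' p g)).trans
      (max_le_max (lp.norm_apply_le_norm ENNReal.top_ne_zero _ _)
        (lp.norm_apply_le_norm ENNReal.top_ne_zero _ _))

variable [TopologicalSpace E] [IsTopologicalAddGroup E] [IsUltrametricDist K] [CompleteSpace K]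

/-- Each coordinate is controlled by its seminorm `p`; conversely, Hahn–Banach detects every point
with `1 < p x`. -/
theorem isInducing_evalBoundedDual (hK : IsSphericallyComplete K)
    (hE : IsNonarchLocallyConvex K E) : Topology.IsInducing (evalBoundedDual K E) := by
  have hcont : Continuous (evalBoundedDual K E) := by
    refine continuous_of_continuousAt_zero (evalBoundedDual K E) ?_
    rw [continuousAt_pi]
    intro p
    rw [ContinuousAt, map_zero, Pi.zero_apply, Metric.tendsto_nhds]
    intro ε hε
    obtain ⟨a, ha0, ha⟩ := NormedField.exists_norm_lt K hε
    have : {x | p.1 x < ‖a‖} ∈ 𝓝 (0 : E) :=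
      (isOpen_lt p.2.1 continuous_const).mem_nhds (by simpa using ha0)
    filter_upwards [this] with x hx
    rw [dist_zero_right]
    exact (norm_evalDualBall_le p.1 ha0 (le_of_lt hx)).trans_lt ha
  have hnhds : Filter.comap (evalBoundedDual K E) (𝓝 0) ≤ 𝓝 0 := by
    intro U hU
    obtain ⟨p, hpc, hpn, hpU⟩ := hE.exists_seminorm hU
    refine ⟨{h | ‖h ⟨p, hpc, hpn⟩‖ < 1}, ?_, ?_⟩
    · exact (isOpen_lt (continuous_apply _).norm continuous_const).mem_nhds (by simp)
    · intro x hx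
      apply hpU
      by_contra hpx
      obtain ⟨g, hg, hgx⟩ := hK.exists_mem_dualBall hpn (not_le.1 hpx)
      exact (hgx.trans (lp.norm_apply_le_norm ENNReal.top_ne_zero (evalDualBall p x)
        ⟨g, hg⟩)).not_gt hx
  rw [IsTopologicalAddGroup.isInducing_iff_nhds_zero]
  refine le_antisymm ?_ hnhds
  simpa using (hcont.tendsto 0).le_comap

theorem IsNonarchAbsConvex.image {K E G : Type*} [NormedField K] [AddCommGroup E] [Module K E]
    [AddCommGroup G] [Module K G] {A : Set E} (hA : IsNonarchAbsConvex K A) (f : E →ₗ[K] G) :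
    IsNonarchAbsConvex K (f '' A) where
  zero_mem := ⟨0, hA.zero_mem, map_zero f⟩
  add_mem := by
    rintro _ ⟨x, hx, rfl⟩ _ ⟨y, hy, rfl⟩
    exact ⟨x + y, hA.add_mem x hx y hy, map_add f x y⟩
  smul_mem := by
    rintro a ha _ ⟨x, hx, rfl⟩
    exact ⟨a • x, hA.smul_mem a ha x hx, map_smul f a x⟩

/-- The functionals `g x` serve all `γ` at once, so the values `γ a` are approximated by
combinations of the coefficient functions with scalars `g x a` free of `γ`. -/
theorem isLocalCompactoid_evalBoundedDual (hK : IsSphericallyComplete K)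
    (hE : IsNonarchLocallyConvex K E) {A : Set E} (hA : IsCPrecompact K A) :
    IsLocalCompactoid K (evalBoundedDual K E '' A) := by
  classical
  refine ⟨hA.1.image _, fun U hU => ?_⟩
  rw [nhds_pi, Filter.mem_pi] at hU
  obtain ⟨I, hI, V, hV, hVU⟩ := hU
  have hμ : ∀ p : ContNonarchSeminorm K E, ∃ μ : K, 0 < ‖μ‖ ∧
      Metric.closedBall 0 ‖μ‖ ⊆ V p := fun p => by
    obtain ⟨ε, hε, hεV⟩ := Metric.mem_nhds_iff.1 (hV p)
    obtain ⟨μ, hμ0, hμ⟩ := NormedField.exists_norm_lt K hε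
    exact ⟨μ, hμ0, (Metric.closedBall_subset_ball hμ).trans hεV⟩
  choose μ hμ0 hμV using hμ
  obtain ⟨p₀, hp₀c, hp₀n, hp₀⟩ := hE.exists_seminorm (U := ⋂ p ∈ I, {x | p.1 x < ‖μ p‖})
    ((Filter.biInter_mem hI).2 fun p _ =>
      (isOpen_lt p.2.1 continuous_const).mem_nhds (by simpa using hμ0 p))
  obtain ⟨s, g, C, hC⟩ := hA.exists_approximation hK hp₀c hp₀n
  have hγ : ∀ (p : ContNonarchSeminorm K E) (γ : dualBall p.1), ∃ c : s → K,
      (∀ x, ‖c x‖ ≤ max (‖μ p‖ * C) 0) ∧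
        (p ∈ I → ∀ a ∈ A, ‖(γ : E →ₗ[K] K) a - ∑ x, g x a * c x‖ ≤ ‖μ p‖) := by
    intro p γ
    by_cases hp : p ∈ I
    · have hμne : μ p ≠ 0 := norm_pos_iff.1 (hμ0 p)
      -- The choice of `p₀` makes this rescaled functional bounded by 1 on its unit ball, one
      -- seminorm serving all of `I`.
      obtain ⟨c, hc, hca⟩ := hC ((μ p)⁻¹ • (γ : E →ₗ[K] K)) fun a ha => by
        have h1 := norm_le_of_mem_dualBall γ.2 (hμ0 p)
          (le_of_lt (Set.mem_iInter₂.1 (hp₀ ha) p hp))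
        rwa [LinearMap.smul_apply, smul_eq_mul, norm_mul, norm_inv, inv_mul_le_one₀ (hμ0 p)]
      refine ⟨fun x => μ p * c x, fun x => ?_, fun _ a ha => ?_⟩
      · rw [norm_mul]
        exact le_max_of_le_left (mul_le_mul_of_nonneg_left (hc x) (norm_nonneg _))
      · have h1 : (γ : E →ₗ[K] K) a - ∑ x, g x a * (μ p * c x)
            = μ p * (((μ p)⁻¹ • (γ : E →ₗ[K] K)) a - ∑ x, g x a * c x) := by
          rw [mul_sub, LinearMap.smul_apply, smul_eq_mul, mul_inv_cancel_left₀ hμne,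
            Finset.mul_sum]
          congr 1
          exact Finset.sum_congr rfl fun x _ => by ring
        rw [h1, norm_mul]
        exact mul_le_of_le_one_right (norm_nonneg _) (hca a ha)
    · exact ⟨0, fun x => by simp, fun h => absurd h hp⟩
  choose c hcb hca using hγ
  let t : s → BoundedDual K E := fun x p => ⟨fun γ => c p γ x, memℓp_infty ⟨max (‖μ p‖ * C) 0, by
    rintro _ ⟨γ, rfl⟩
    exact hcb p γ x⟩⟩
  refine ⟨Finset.univ.image t, ?_⟩
  rintro _ ⟨a, ha, rfl⟩
  have hspan : ∑ x, g x a • t x ∈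
      Submodule.span K ((Finset.univ.image t : Finset (BoundedDual K E)) : Set (BoundedDual K E)) :=
    Submodule.sum_mem _ fun x _ => Submodule.smul_mem _ _ (Submodule.subset_span (by simp))
  refine ⟨evalBoundedDual K E a - ∑ x, g x a • t x, hVU fun p hp => hμV p ?_, _, hspan,
    sub_add_cancel _ _⟩
  rw [mem_closedBall_zero_iff]
  refine lp.norm_le_of_forall_le (norm_nonneg _) fun γ => ?_
  have h1 := hca p γ hp a ha
  have h2 : (evalBoundedDual K E a - ∑ x, g x a • t x) p γ
      = (γ : E →ₗ[K] K) a - ∑ x, g x a * c p γ x := by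
    rw [Pi.sub_apply, Finset.sum_apply, lp.coeFn_sub, lp.coeFn_sum, Pi.sub_apply, Finset.sum_apply]
    rfl
  rw [h2]
  exact h1

end Evaluation

/-! ### From an inducing map to an embedding, and universe bounds -/

section Main

open scoped ENNReal

/-- A map that induces the topology of `E` can be replaced by an embedding, into a space in
any universe in which the target is small. -/
theorem exists_isEmbedding_of_isInducing {K : Type u} [NontriviallyNormedField K]
    {E : Type v} [AddCommGroup E] [Module K E] [TopologicalSpace E] {A : Set E}
    (hA : IsNonarchAbsConvex K A)
    {H : Type*} [AddCommGroup H] [Module K H] [TopologicalSpace H] [IsTopologicalAddGroup H]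
    [ContinuousSMul K H] [Small.{max v w} H] (hH : IsNonarchLocallyConvex K H) (φ : E →ₗ[K] H)
    (hφ : Topology.IsInducing φ) (hφA : IsLocalCompactoid K (φ '' A)) :
    ∃ (G : Type (max v w)) (_ : AddCommGroup G) (_ : Module K G) (_ : TopologicalSpace G)
      (_ : IsTopologicalAddGroup G) (_ : ContinuousSMul K G) (f : E →L[K] G),
      IsNonarchLocallyConvex K G ∧ Topology.IsEmbedding f ∧ IsLocalCompactoid K (f '' A) := by
  classical
  let e : Shrink.{max v w} H ≃ₗ[K] H := Shrink.linearEquiv K H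
  let π : Shrink.{max v w} H × E →ₗ[K] H := e.toLinearMap ∘ₗ LinearMap.fst K _ E
  -- The factor `E` is topologically invisible: it restores injectivity when `E` is not Hausdorff.
  let τ : TopologicalSpace (Shrink.{max v w} H × E) := TopologicalSpace.induced π inferInstance
  have hτ : @IsTopologicalAddGroup _ τ _ := topologicalAddGroup_induced π
  have hτ' : @ContinuousSMul K _ _ _ τ := continuousSMul_induced π
  have hπ : @Topology.IsInducing _ _ τ _ π := @Topology.IsInducing.mk _ _ τ _ π rfl
  let f : E →ₗ[K] Shrink.{max v w} H × E := (e.symm.toLinearMap ∘ₗ φ).prod LinearMap.id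
  have hπf : ∀ x, π (f x) = φ x := fun x => e.apply_symm_apply (φ x)
  have hf : @Topology.IsInducing _ _ _ τ f :=
    hπ.of_comp_iff.1 ((funext hπf : π ∘ f = φ) ▸ hφ)
  refine ⟨Shrink.{max v w} H × E, inferInstance, inferInstance, τ, hτ, hτ', ⟨f, hf.continuous⟩,
    ?_, ⟨hf, fun x y hxy => congrArg Prod.snd hxy⟩, hA.image f, fun U hU => ?_⟩
  · obtain ⟨P, hP, hw⟩ := hH
    refine isNonarchLocallyConvex_of_family (hπ.withSeminorms hw) fun p x y => ?_
    have := hP p p.2 (π x) (π y)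
    rwa [← map_add] at this
  · rw [hπ.nhds_eq_comap, map_zero] at hU
    obtain ⟨V, hV, hVU⟩ := hU
    obtain ⟨T, hT⟩ := hφA.2 V hV
    let j : H →ₗ[K] Shrink.{max v w} H × E := LinearMap.inl K _ E ∘ₗ e.symm.toLinearMap
    have hπj : ∀ h, π (j h) = h := fun h => e.apply_symm_apply h
    refine ⟨T.image j, ?_⟩
    rintro _ ⟨a, ha, rfl⟩
    obtain ⟨v, hv, t, ht, hvt⟩ := hT ⟨a, ha, rfl⟩
    refine ⟨f a - j t, hVU ?_, j t, ?_, sub_add_cancel _ _⟩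
    · rw [Set.mem_preimage, map_sub, hπf, hπj, ← hvt]
      simpa using hv
    · rw [Finset.coe_image, ← Submodule.map_span]
      exact Submodule.mem_map_of_mem ht

/-- A nonzero vector embeds `K` in `E`, so the universe of `K` does not matter. -/
theorem small_boundedDual {K : Type u} [NontriviallyNormedField K] {E : Type v} [AddCommGroup E]
    [Module K E] [TopologicalSpace E] [Nontrivial E] : Small.{max v w} (BoundedDual K E) := by
  obtain ⟨x, hx⟩ := exists_ne (0 : E)
  have hE : Small.{max v w} E := small_max.{w} E
  have hKs : Small.{max v w} K := small_of_injective (smul_left_injective K hx)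
  have h1 : Small.{max v w} (Seminorm K E) :=
    have : Small.{max v w} ℝ := small_zero ℝ
    small_of_injective (β := E → ℝ) DFunLike.coe_injective
  have h2 : Small.{max v w} (E →ₗ[K] K) := small_of_injective (β := E → K) DFunLike.coe_injective
  have h3 : ∀ p : ContNonarchSeminorm K E, Small.{max v w} (lp (fun _ : dualBall p.1 => K) ∞) :=
    fun p => small_of_injective (β := dualBall p.1 → K) fun a b h => lp.ext h
  infer_instance

end Main

theorem mainTheorem1 {K : Type u} [NontriviallyNormedField K] [IsUltrametricDist K]
    [CompleteSpace K] (hK : IsSphericallyComplete K)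
    {E : Type v} [AddCommGroup E] [Module K E] [TopologicalSpace E] [IsTopologicalAddGroup E]
    [ContinuousSMul K E] (hE : IsNonarchLocallyConvex K E)
    (A : Set E) (hA : IsNonarchAbsConvex K A) :
    IsCPrecompact K A ↔
      ∃ (G : Type (max v w)) (_ : AddCommGroup G) (_ : Module K G) (_ : TopologicalSpace G)
        (_ : IsTopologicalAddGroup G) (_ : ContinuousSMul K G) (f : E →L[K] G),
        IsNonarchLocallyConvex K G ∧ Topology.IsEmbedding f ∧ IsLocalCompactoid K (f '' A) := by
  constructor
  · intro h
    -- For trivial `E` the evaluation target still involves `K`, which may be too large; `E` itself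
    -- serves instead.
    rcases subsingleton_or_nontrivial E with hsub | hnt
    · refine exists_isEmbedding_of_isInducing hA (H := E) hE LinearMap.id .id ⟨hA.image _, ?_⟩
      intro U hU
      refine ⟨∅, fun x _ => ⟨0, mem_of_mem_nhds hU, 0, Submodule.zero_mem _,
        Subsingleton.elim _ _⟩⟩
    · have := small_boundedDual.{u, v, w} (K := K) (E := E)
      exact exists_isEmbedding_of_isInducing hA isNonarchLocallyConvex_boundedDual
        (evalBoundedDual K E) (isInducing_evalBoundedDual hK hE)
        (isLocalCompactoid_evalBoundedDual hK hE h)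
  · rintro ⟨G, _, _, _, _, _, f, hG, hf, hfA⟩
    exact isCPrecompact_of_isLocalCompactoid hK hA hG f.toLinearMap hf.isInducing hfA
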